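/- Let $m\ge 1$ and $n\ge 2$, and let $F_n$ be the free group with basis $x_1,\dots,x_n$. For a homomorphism $\alpha\colon F_n\to \mathrm{GL}_m(\mathbb Z)$, $u\mapsto A_u$, let $F_n\ltimes_\alpha\mathbb Z^m$ be the semidirect product in which $u^{-1}t^{a}u=t^{aA_u}$ for $u\in F_n$ and row vectors $a\in\mathbb Z^m$, where $t^a$ denotes the element $a$ of the factor $\mathbb Z^m$ written multiplicatively. (1) If $\alpha,\beta\colon F_n\to \mathrm{GL}_m(\mathbb Z)$ are injective, then $F_n\ltimes_\alpha\mathbb Z^m\cong F_n\ltimes_\beta\mathbb Z^m$ if and only if $Q^{-1}\,\mathrm{im}(\alpha)\,Q=\mathrm{im}(\beta)$ for some $Q\in \mathrm{GL}_m(\mathbb Z)$. (2) Consider the following two decision problems, in which only the stated inputs are legitimate. * $\mathrm{IP}(F_n\ltimes_{inj}\mathbb Z^m)$: an input is a pair of $n$-tuples $(A_1,\dots,A_n)$, $(B_1,\dots,B_n)$ of matrices in $\mathrm{GL}_m(\mathbb Z)$ such that the homomorphisms $\alpha,\beta\colon F_n\to \mathrm{GL}_m(\mathbb Z)$ with $\alpha(x_i)=A_i$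 and $\beta(x_i)=B_i$ are injective; the question is whether $F_n\ltimes_\alpha\mathbb Z^m\cong F_n\ltimes_\beta\mathbb Z^m$. * $\mathrm{CFSCP}(\mathrm{GL}_m(\mathbb Z),n)$, with respect to a finite generating family $X$ of $\mathrm{GL}_m(\mathbb Z)$: an input is a pair of finite sets $S,T$ of words in $X^{\pm}$ such that the subgroups $\langle S\rangle$ and $\langle T\rangle$ of $\mathrm{GL}_m(\mathbb Z)$ are both free of rank $n$; the question is whether $\langle S\rangle$ and $\langle T\rangle$ are conjugate in $\mathrm{GL}_m(\mathbb Z)$. For every finite generating family $X$, the two problems are Turing equivalent: $\mathrm{IP}(F_n\ltimes_{inj}\mathbb Z^m)\equiv_T \mathrm{CFSCP}(\mathrm{GL}_m(\mathbb Z),n)$, meaning that each of the two partial answer functions (defined exactly on the legitimate inputs) is partial recursive relative to the other. Moreover, $\mathrm{IP}(F_n\ltimes_{inj}\mathbb Z^m)$ is decidable if and only if $\mathrm{CFSCP}(\mathrm{GL}_m(\mathbb Z),n)$ is, where a problem is decidable if some algorithm halts with the correct answer on every legitimate input (with no requirement on other inputs). -/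

import Mathlib

open scoped Computability Matrix MatrixGroups

/-! ### Decision problems with restricted inputs -/

/-- A decision problem over codes of type `α`: the codes `x` with `input x` are the legitimate
inputs, and on a legitimate input `x` the correct answer is "yes" exactly when `cond x` holds.
Nothing is asked about the other codes. -/
structure DecisionProblem (α : Type) where
  input : α → Prop
  cond : α → Prop

namespace DecisionProblem

variable {α : Type}

open Classical in
/-- The correct answer, as a partial function that is defined exactly on the legitimate inputs. -/
noncomputable def answer (P : DecisionProblem α) : α →. Bool :=
  fun x => ⟨P.input x, fun _ => decide (P.cond x)⟩

/-- The partial function `answer` read on natural numbers, through the coding of `α`. -/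
noncomputable def coded [Primcodable α] (P : DecisionProblem α) : ℕ →. ℕ :=
  fun k => Part.bind (Encodable.decode (α := α) k : Option α)
    fun x => (P.answer x).map Encodable.encode

/-- `P` is decidable: some algorithm halts with the correct answer on every legitimate input.
Its behaviour on the other codes is arbitrary (it may answer anything, or not halt). -/
def IsDecidable [Primcodable α] (P : DecisionProblem α) : Prop :=
  ∃ f : α →. Bool, Partrec f ∧
    ∀ x, P.input x → ∃ b : Bool, f x = Part.some b ∧ (b = true ↔ P.cond x)

/-- Turing equivalence of decision problems: each of the two partial answer functions is partial
recursive with the other one as an oracle. (A computation that consults an oracle outside its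
domain does not halt; so the reductions only ever use answers to legitimate questions, and they
keep working with any oracle that is correct on the legitimate inputs.) -/
def TuringEquiv {β : Type} [Primcodable α] [Primcodable β]
    (P : DecisionProblem α) (Q : DecisionProblem β) : Prop :=
  P.coded ≡ᵀ Q.coded

end DecisionProblem

/-- The coding of integers by natural numbers `0, -1, 1, -2, 2, … ↦ 0, 1, 2, 3, 4, …`. -/
instance intPrimcodable : Primcodable ℤ := Primcodable.ofEquiv ℕ Equiv.intEquivNat

/-- An `m × m` integer matrix is coded as the table of its entries. -/
instance intMatrixPrimcodable (m : ℕ) : Primcodable (Matrix (Fin m) (Fin m) ℤ) :=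
  inferInstanceAs (Primcodable (Fin m → Fin m → ℤ))

/-! ### Free-abelian by free groups -/

/-- The action of `GL_m(ℤ)` on row vectors in `ℤ^m`: the automorphism attached to `A` is
`a ↦ a A⁻¹`, so that in the semidirect product below `u⁻¹ t^a u = t^(a A_u)`. -/
def rowAction (m : ℕ) : GL (Fin m) ℤ →* MulAut (Multiplicative (Fin m → ℤ)) where
  toFun A :=
    { toFun := fun a => Multiplicative.ofAdd
        (a.toAdd ᵥ* ((A⁻¹ : GL (Fin m) ℤ) : Matrix (Fin m) (Fin m) ℤ))
      invFun := fun a => Multiplicative.ofAdd (a.toAdd ᵥ* (A : Matrix (Fin m) (Fin m) ℤ))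
      left_inv := fun a => by
        simp only [toAdd_ofAdd, Matrix.vecMul_vecMul, ← Units.val_mul, inv_mul_cancel,
          Units.val_one, Matrix.vecMul_one, ofAdd_toAdd]
      right_inv := fun a => by
        simp only [toAdd_ofAdd, Matrix.vecMul_vecMul, ← Units.val_mul, mul_inv_cancel,
          Units.val_one, Matrix.vecMul_one, ofAdd_toAdd]
      map_mul' := fun a b => by
        simp only [toAdd_mul, Matrix.add_vecMul, ofAdd_add] }
  map_one' := by
    ext a
    simp
  map_mul' A B := by
    apply MulEquiv.ext
    intro a
    change a.toAdd ᵥ* (((A * B)⁻¹ : GL (Fin m) ℤ) : Matrix (Fin m) (Fin m) ℤ) =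
      (a.toAdd ᵥ* ((B⁻¹ : GL (Fin m) ℤ) : Matrix (Fin m) (Fin m) ℤ)) ᵥ*
        ((A⁻¹ : GL (Fin m) ℤ) : Matrix (Fin m) (Fin m) ℤ)
    rw [Matrix.vecMul_vecMul, ← Units.val_mul, mul_inv_rev]

/-- The group `F_n ⋉_α ℤ^m` given by an action `α : F_n → GL_m(ℤ)`. -/
abbrev FABF {m n : ℕ} (α : FreeGroup (Fin n) →* GL (Fin m) ℤ) : Type :=
  Multiplicative (Fin m → ℤ) ⋊[(rowAction m).comp α] FreeGroup (Fin n)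

/-- The tuple `A` lists the images under `α` of the standard basis of `F_n`. -/
def Represents {m n : ℕ} (A : Fin n → Matrix (Fin m) (Fin m) ℤ)
    (α : FreeGroup (Fin n) →* GL (Fin m) ℤ) : Prop :=
  ∀ i, (α (FreeGroup.of i) : Matrix (Fin m) (Fin m) ℤ) = A i

/-- The isomorphism problem for the groups `F_n ⋉ ℤ^m` with faithful action. An input is a pair of
injective homomorphisms `α, β : F_n → GL_m(ℤ)`, each given by the `n`-tuple of matrices that are
the images of the standard basis; the question is whether `F_n ⋉_α ℤ^m ≅ F_n ⋉_β ℤ^m`. -/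
def faithfulIP (m n : ℕ) : DecisionProblem
    ((Fin n → Matrix (Fin m) (Fin m) ℤ) × (Fin n → Matrix (Fin m) (Fin m) ℤ)) where
  input p := ∃ α β : FreeGroup (Fin n) →* GL (Fin m) ℤ,
    Represents p.1 α ∧ Represents p.2 β ∧ Function.Injective α ∧ Function.Injective β
  cond p := ∃ α β : FreeGroup (Fin n) →* GL (Fin m) ℤ,
    Represents p.1 α ∧ Represents p.2 β ∧ Nonempty (FABF α ≃* FABF β)

/-! ### The constrained free subgroup conjugacy problem -/

/-- `g⁻¹ H g = K` for some `g`. -/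
def AreConjugate {G : Type*} [Group G] (H K : Subgroup G) : Prop :=
  ∃ g : G, H.map (MulAut.conj g⁻¹).toMonoidHom = K

/-- The value in `G` of a word in the letters `X i` (written `(i, true)`) and `(X i)⁻¹`
(written `(i, false)`). -/
def evalWord {G ι : Type*} [Group G] (X : ι → G) (w : List (ι × Bool)) : G :=
  (w.map fun l => if l.2 then X l.1 else (X l.1)⁻¹).prod

/-- The subgroup of `G` generated by the elements that the words of the finite list `S` spell. -/
def wordSubgroup {G ι : Type*} [Group G] (X : ι → G) (S : List (List (ι × Bool))) : Subgroup G :=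
  Subgroup.closure {g | ∃ w ∈ S, evalWord X w = g}

/-- The `n`-constrained free subgroup conjugacy problem for the group `G` generated by the family
`X`. An input is a pair of finite sets `S, T` of words in `X^±` (given as lists) such that the
subgroups `⟨S⟩` and `⟨T⟩` of `G` are both free of rank `n`; the question is whether these two
subgroups are conjugate in `G`. -/
def CFSCP {G : Type*} {ι : Type} [Group G] (X : ι → G) (n : ℕ) :
    DecisionProblem (List (List (ι × Bool)) × List (List (ι × Bool))) where
  input p := Nonempty (wordSubgroup X p.1 ≃* FreeGroup (Fin n)) ∧
    Nonempty (wordSubgroup X p.2 ≃* FreeGroup (Fin n))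
  cond p := AreConjugate (wordSubgroup X p.1) (wordSubgroup X p.2)

/-! The factor `ℤ^m` is recognisable inside `F_n ⋉ ℤ^m`: a commutative normal subgroup projects to a
commutative normal subgroup of `F_n`, which is trivial for `n ≥ 2`
(`FreeGroup.eq_bot_of_normal_of_commute`). An isomorphism therefore restricts to an isomorphism of
the abelian factors, that is, to a matrix in `GL_m(ℤ)`, and is onto modulo those factors; comparing
the conjugation actions shows that this matrix conjugates one image to the other. Conversely, for
injective actions a conjugating matrix determines an automorphism of `F_n`, and the two together
give an isomorphism.

For the decision problems, both kinds of input describe pairs of subgroups, by matrices or by words.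
Each translation is an unbounded search for a certificate that the two descriptions generate the
same subgroups. Legitimacy then transfers by the Hopf property: `GL_m(ℤ)` is residually finite, so
by Malcev's argument `n` elements generating a free subgroup of rank `n` are a basis of it
(`FreeGroup.injective_iff_nonempty_range_equiv`). -/

/-! ### Abelian normal subgroups of free groups -/

/-- Distinct members of a basis of a free group do not commute. -/
theorem FreeGroup.not_commute_of {ι : Type*} {x y : ι} (h : x ≠ y) :
    ¬ Commute (FreeGroup.of x) (FreeGroup.of y) := by
  classical
  intro hc
  -- Map to the symmetric group on three points, where the two transpositions do not commute.
  have h3 := hc.map (FreeGroup.lift fun z : ι =>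
    if z = x then Equiv.swap (0 : Fin 3) 1 else Equiv.swap (1 : Fin 3) 2)
  simp only [FreeGroup.lift_apply_of, if_true, if_neg h.symm] at h3
  exact absurd h3 (by unfold Commute SemiconjBy; decide)

/-- A commutative subgroup of a free group is cyclic. -/
theorem Subgroup.exists_zpowers_eq_of_commute_of_isFreeGroup {F : Type*} [Group F] [IsFreeGroup F]
    (H : Subgroup F) (hH : ∀ a ∈ H, ∀ b ∈ H, Commute a b) : ∃ c, Subgroup.zpowers c = H := by
  rw [← Subgroup.isCyclic_iff_exists_zpowers_eq_top]
  -- By Nielsen–Schreier `H` is free; commutativity leaves room for at most one generator.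
  let e := IsFreeGroup.toFreeGroup H
  have hs : Subsingleton (IsFreeGroup.Generators H) := by
    refine ⟨fun x y => ?_⟩
    by_contra hxy
    refine FreeGroup.not_commute_of hxy ?_
    have hc : Commute (e.symm (FreeGroup.of x)) (e.symm (FreeGroup.of y)) :=
      Subtype.ext (hH _ (e.symm (FreeGroup.of x)).2 _ (e.symm (FreeGroup.of y)).2)
    simpa using hc.map e
  have : IsCyclic (FreeGroup (IsFreeGroup.Generators H)) := by
    rcases isEmpty_or_nonempty (IsFreeGroup.Generators H) with h | ⟨⟨x⟩⟩
    · infer_instance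
    · have : Unique (IsFreeGroup.Generators H) := uniqueOfSubsingleton x
      infer_instance
  exact isCyclic_of_surjective e.symm e.symm.surjective

/-- Two commuting elements of a free group are powers of a common element. -/
theorem Commute.exists_zpow_of_isFreeGroup {F : Type*} [Group F] [IsFreeGroup F] {a b : F}
    (h : Commute a b) : ∃ (d : F) (i j : ℤ), d ^ i = a ∧ d ^ j = b := by
  have hc : ∀ x ∈ Subgroup.closure {a, b}, ∀ y ∈ Subgroup.closure {a, b}, Commute x y := by
    have hcomm : ∀ x ∈ ({a, b} : Set F), ∀ y ∈ ({a, b} : Set F), x * y = y * x := by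
      rintro x (rfl | rfl) y (rfl | rfl)
      exacts [rfl, h, h.symm, rfl]
    have := Subgroup.isMulCommutative_closure hcomm
    intro x hx y hy
    exact congrArg Subtype.val (this.is_comm.comm ⟨x, hx⟩ ⟨y, hy⟩)
  obtain ⟨d, hd⟩ := Subgroup.exists_zpowers_eq_of_commute_of_isFreeGroup _ hc
  have ha : a ∈ Subgroup.zpowers d := hd ▸ Subgroup.subset_closure (by simp)
  have hb : b ∈ Subgroup.zpowers d := hd ▸ Subgroup.subset_closure (by simp)
  obtain ⟨i, hi⟩ := Subgroup.mem_zpowers_iff.1 ha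
  obtain ⟨j, hj⟩ := Subgroup.mem_zpowers_iff.1 hb
  exact ⟨d, i, j, hi, hj⟩

/-- A nontrivial element of a free group that commutes with a square `g ^ 2` has a power which is
a nontrivial power of `g`. -/
theorem FreeGroup.exists_zpow_eq_zpow {ι : Type*} {c g : FreeGroup ι} (hc : c ≠ 1)
    (h : Commute c (g ^ 2)) : ∃ i j : ℤ, j ≠ 0 ∧ c ^ i = g ^ j := by
  obtain ⟨d, i, j, hi, hj⟩ := h.exists_zpow_of_isFreeGroup
  have hi0 : i ≠ 0 := by rintro rfl; exact hc (by simpa using hi.symm)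
  -- With `c = d ^ i` and `g ^ 2 = d ^ j`, both sides equal `d ^ (i * j)`.
  refine ⟨j, 2 * i, by simpa using hi0, ?_⟩
  rw [zpow_mul, ← hi, ← zpow_mul, mul_comm, zpow_mul, hj]
  rfl

/-- A commutative normal subgroup of a free group on at least two generators is trivial. -/
theorem FreeGroup.eq_bot_of_normal_of_commute {ι : Type*} [Nontrivial ι]
    (N : Subgroup (FreeGroup ι)) [hN : N.Normal] (h : ∀ a ∈ N, ∀ b ∈ N, Commute a b) :
    N = ⊥ := by
  classical
  obtain ⟨c, rfl⟩ := N.exists_zpowers_eq_of_commute_of_isFreeGroup h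
  rw [Subgroup.zpowers_eq_bot]
  by_contra hc
  have hinj : Function.Injective fun k : ℤ => c ^ k :=
    injective_zpow_iff_not_isOfFinOrder.2 (by rwa [isOfFinOrder_iff_eq_one])
  -- Conjugation by `g` is an automorphism of the infinite cyclic group generated by `c`, hence `c ↦
  -- c ^ (±1)`, and its square is trivial.
  have hsq : ∀ g : FreeGroup ι, Commute c (g ^ 2) := by
    intro g
    obtain ⟨k, hk⟩ := Subgroup.mem_zpowers_iff.1 (hN.conj_mem c (Subgroup.mem_zpowers c) g)
    obtain ⟨l, hl⟩ := Subgroup.mem_zpowers_iff.1 (hN.conj_mem c (Subgroup.mem_zpowers c) g⁻¹)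
    have hkl : c ^ (k * l) = c ^ (1 : ℤ) := by
      rw [zpow_mul, hk, conj_zpow, hl]; group
    have hkk : k * k = 1 := by
      rcases Int.mul_eq_one_iff_eq_one_or_neg_one.1 (hinj hkl) with ⟨rfl, -⟩ | ⟨rfl, -⟩ <;> rfl
    have h2 : g ^ 2 * c * (g ^ 2)⁻¹ = c := by
      calc g ^ 2 * c * (g ^ 2)⁻¹ = g * (g * c * g⁻¹) * g⁻¹ := by simp only [pow_two]; group
        _ = (g * c * g⁻¹) ^ k := by rw [← hk, ← conj_zpow, hk]
        _ = c := by rw [← hk, ← zpow_mul, hkk, zpow_one]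
    exact (mul_inv_eq_iff_eq_mul.1 h2).symm
  obtain ⟨x, y, hxy⟩ := exists_pair_ne ι
  obtain ⟨i, j, hj, hij⟩ := FreeGroup.exists_zpow_eq_zpow hc (hsq (FreeGroup.of x))
  obtain ⟨i', j', hj', hij'⟩ := FreeGroup.exists_zpow_eq_zpow hc (hsq (FreeGroup.of y))
  have key : FreeGroup.of x ^ (j * i') = FreeGroup.of y ^ (j' * i) := by
    rw [zpow_mul, ← hij, zpow_mul, ← hij', ← zpow_mul, ← zpow_mul, mul_comm]
  -- The exponent sum in `x` kills the power of `y`, which forces `i' = 0`; then `y ^ j' = 1`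
  -- contradicts torsion-freeness.
  have hmap := congrArg (FreeGroup.lift fun z : ι =>
    if z = x then Multiplicative.ofAdd (1 : ℤ) else 1) key
  simp only [map_zpow, FreeGroup.lift_apply_of, if_true, if_neg hxy.symm, one_zpow] at hmap
  have hji : j * i' = 0 := by
    rw [← ofAdd_zsmul, ← ofAdd_zero] at hmap
    simpa using Multiplicative.ofAdd.injective hmap
  have hi' : i' = 0 := (mul_eq_zero.1 hji).resolve_left hj
  rw [hi', zpow_zero] at hij'
  have := injective_zpow_iff_not_isOfFinOrder.2
    (by rw [isOfFinOrder_iff_eq_one]; exact FreeGroup.of_ne_one y) ((hij'.symm.trans (zpow_zero _).symm))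
  exact hj' this

/-! ### Isomorphisms of free-abelian by free groups -/

/-- In a semidirect product of `N` with a free group of rank at least two, every commutative normal
subgroup lies in `N`. -/
theorem SemidirectProduct.right_eq_one_of_mem_normal {N ι : Type*} [Group N] [Nontrivial ι]
    {φ : FreeGroup ι →* MulAut N} (K : Subgroup (N ⋊[φ] FreeGroup ι)) (hK : K.Normal)
    (h : ∀ a ∈ K, ∀ b ∈ K, Commute a b) {x : N ⋊[φ] FreeGroup ι} (hx : x ∈ K) : x.right = 1 := by
  have : (K.map SemidirectProduct.rightHom).Normal := hK.map _ SemidirectProduct.rightHom_surjective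
  have hbot := FreeGroup.eq_bot_of_normal_of_commute (K.map SemidirectProduct.rightHom) (by
    rintro _ ⟨a, ha, rfl⟩ _ ⟨b, hb, rfl⟩
    exact (h a ha b hb).map _)
  exact (Subgroup.eq_bot_iff_forall _).1 hbot _ (Subgroup.mem_map_of_mem _ hx)

/-- An isomorphism between semidirect products of commutative groups with free groups of rank at
least two preserves the commutative factor. -/
theorem SemidirectProduct.inl_left_apply_inl {N N' ι ι' : Type*} [CommGroup N] [Group N']
    [Nontrivial ι'] {φ : FreeGroup ι →* MulAut N} {φ' : FreeGroup ι' →* MulAut N'}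
    (f : N ⋊[φ] FreeGroup ι ≃* N' ⋊[φ'] FreeGroup ι') (a : N) :
    SemidirectProduct.inl (f (SemidirectProduct.inl a)).left = f (SemidirectProduct.inl a) := by
  let K := (SemidirectProduct.inl : N →* N ⋊[φ] FreeGroup ι).range
  have hK : K.Normal := by
    dsimp only [K]
    rw [SemidirectProduct.range_inl_eq_ker_rightHom]; infer_instance
  have h1 : (f (SemidirectProduct.inl a)).right = 1 :=
    SemidirectProduct.right_eq_one_of_mem_normal (K.map f.toMonoidHom)
      (hK.map _ f.surjective) (by
        rintro _ ⟨_, ⟨b, rfl⟩, rfl⟩ _ ⟨_, ⟨c, rfl⟩, rfl⟩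
        exact ((Commute.all b c).map SemidirectProduct.inl).map _)
      (Subgroup.mem_map_of_mem _ ⟨a, rfl⟩)
  ext <;> simp [h1]

theorem rowAction_apply {m : ℕ} (A : GL (Fin m) ℤ) (a : Multiplicative (Fin m → ℤ)) :
    rowAction m A a = Multiplicative.ofAdd
      (a.toAdd ᵥ* ((A⁻¹ : GL (Fin m) ℤ) : Matrix (Fin m) (Fin m) ℤ)) := rfl

theorem rowAction_injective (m : ℕ) : Function.Injective (rowAction m) := by
  intro A B h
  rw [← inv_inj]
  apply Units.ext
  apply Matrix.ext_of_single_vecMul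
  intro i
  simpa [rowAction_apply] using
    DFunLike.congr_fun h (Multiplicative.ofAdd (Pi.single i (1 : ℤ)))

/-- Additive automorphisms of `ℤ^m` are `ℤ`-linear, so they are given by invertible matrices. Below,
`A` is the matrix of `f` itself, and the preimage is `A⁻¹` because `rowAction` inverts its argument.
-/
theorem rowAction_surjective (m : ℕ) : Function.Surjective (rowAction m) := by
  intro f
  let e : (Fin m → ℤ) ≃+ (Fin m → ℤ) := AddEquiv.toMultiplicative.symm f.symm
  let L : (Fin m → ℤ) →ₗ[ℤ] (Fin m → ℤ) := e.toAddMonoidHom.toIntLinearMap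
  let L' : (Fin m → ℤ) →ₗ[ℤ] (Fin m → ℤ) := e.symm.toAddMonoidHom.toIntLinearMap
  have h1 : L.comp L' = LinearMap.id := LinearMap.ext fun a => e.apply_symm_apply a
  have h2 : L'.comp L = LinearMap.id := LinearMap.ext fun a => e.symm_apply_apply a
  let A : GL (Fin m) ℤ :=
    { val := LinearMap.toMatrixRight' L'
      inv := LinearMap.toMatrixRight' L
      val_inv := by
        apply Matrix.toLinearMapRight'.injective
        rw [Matrix.toLinearMapRight'_mul]; simpa using h1
      inv_val := by
        apply Matrix.toLinearMapRight'.injective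
        rw [Matrix.toLinearMapRight'_mul]; simpa using h2 }
  refine ⟨A⁻¹, MulEquiv.ext fun a => ?_⟩
  rw [rowAction_apply, inv_inv, ← Matrix.toLinearMapRight'_apply]
  simp only [A]
  simp
  rfl

/-- The automorphism of the commutative factor induced by an isomorphism of semidirect products of
commutative groups with free groups of rank at least two. -/
def SemidirectProduct.leftEquiv {N N' ι ι' : Type*} [CommGroup N] [CommGroup N']
    [Nontrivial ι] [Nontrivial ι'] {φ : FreeGroup ι →* MulAut N} {φ' : FreeGroup ι' →* MulAut N'}
    (f : N ⋊[φ] FreeGroup ι ≃* N' ⋊[φ'] FreeGroup ι') : N ≃* N' where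
  toFun a := (f (SemidirectProduct.inl a)).left
  invFun a := (f.symm (SemidirectProduct.inl a)).left
  left_inv a := by simp [SemidirectProduct.inl_left_apply_inl]
  right_inv a := by simp [SemidirectProduct.inl_left_apply_inl]
  map_mul' a b := SemidirectProduct.inl_injective (φ := φ') (by
    rw [SemidirectProduct.inl_left_apply_inl, map_mul, map_mul, map_mul,
      SemidirectProduct.inl_left_apply_inl, SemidirectProduct.inl_left_apply_inl])

theorem SemidirectProduct.inl_leftEquiv {N N' ι ι' : Type*} [CommGroup N] [CommGroup N']
    [Nontrivial ι] [Nontrivial ι'] {φ : FreeGroup ι →* MulAut N} {φ' : FreeGroup ι' →* MulAut N'}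
    (f : N ⋊[φ] FreeGroup ι ≃* N' ⋊[φ'] FreeGroup ι') (a : N) :
    SemidirectProduct.inl (SemidirectProduct.leftEquiv f a) = f (SemidirectProduct.inl a) :=
  SemidirectProduct.inl_left_apply_inl f a

/-- The action is conjugation by `inr u`. After applying `f` the conjugator may have a component in
`N'`, but this acts trivially on the commutative group `N'`. -/
theorem SemidirectProduct.leftEquiv_apply_apply {N N' ι ι' : Type*} [CommGroup N] [CommGroup N']
    [Nontrivial ι] [Nontrivial ι'] {φ : FreeGroup ι →* MulAut N} {φ' : FreeGroup ι' →* MulAut N'}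
    (f : N ⋊[φ] FreeGroup ι ≃* N' ⋊[φ'] FreeGroup ι') (u : FreeGroup ι) (a : N) :
    SemidirectProduct.leftEquiv f (φ u a) =
      φ' (f (SemidirectProduct.inr u)).right (SemidirectProduct.leftEquiv f a) := by
  have h := SemidirectProduct.inl_leftEquiv f (φ u a)
  rw [SemidirectProduct.inl_aut, map_mul, map_mul, map_inv, map_inv,
    ← SemidirectProduct.inl_leftEquiv] at h
  have h' := congrArg SemidirectProduct.left h
  simpa [mul_right_comm] using h'

theorem SemidirectProduct.surjective_right_apply_inr {N N' ι ι' : Type*} [CommGroup N] [Group N']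
    [Nontrivial ι'] {φ : FreeGroup ι →* MulAut N} {φ' : FreeGroup ι' →* MulAut N'}
    (f : N ⋊[φ] FreeGroup ι ≃* N' ⋊[φ'] FreeGroup ι') :
    Function.Surjective fun u => (f (SemidirectProduct.inr u)).right := by
  intro v
  obtain ⟨x, hx⟩ := f.surjective (SemidirectProduct.inr v)
  refine ⟨x.right, ?_⟩
  rw [← SemidirectProduct.inl_left_mul_inr_right x, map_mul,
    ← SemidirectProduct.inl_left_apply_inl f] at hx
  simpa using congrArg SemidirectProduct.right hx

theorem areConjugate_range_of_equiv {m n : ℕ} (hn : 2 ≤ n) {α β : FreeGroup (Fin n) →* GL (Fin m) ℤ}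
    (f : FABF α ≃* FABF β) : AreConjugate α.range β.range := by
  have : Nontrivial (Fin n) := Fin.nontrivial_iff_two_le.2 hn
  obtain ⟨Q, hQ⟩ := rowAction_surjective m (SemidirectProduct.leftEquiv f)
  have key : ∀ u, Q * α u * Q⁻¹ = β (f (SemidirectProduct.inr u)).right := by
    intro u
    rw [mul_inv_eq_iff_eq_mul]
    apply rowAction_injective m
    rw [map_mul, map_mul, hQ]
    exact MulEquiv.ext (SemidirectProduct.leftEquiv_apply_apply f u)
  -- `AreConjugate` asks for `g⁻¹ H g`, whereas `key` conjugates as `Q H Q⁻¹`.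
  refine ⟨Q⁻¹, le_antisymm ?_ ?_⟩
  · rintro _ ⟨_, ⟨u, rfl⟩, rfl⟩
    exact ⟨_, (key u).symm.trans (by simp)⟩
  · rintro _ ⟨v, rfl⟩
    obtain ⟨u, rfl⟩ := SemidirectProduct.surjective_right_apply_inr f v
    exact ⟨_, ⟨u, rfl⟩, by simp [key]⟩

theorem nonempty_equiv_of_areConjugate_range {m n : ℕ} {α β : FreeGroup (Fin n) →* GL (Fin m) ℤ}
    (hα : Function.Injective α) (hβ : Function.Injective β) (h : AreConjugate α.range β.range) :
    Nonempty (FABF α ≃* FABF β) := by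
  obtain ⟨g, hg⟩ := h
  -- The automorphism `β⁻¹ ∘ (conjugation by g⁻¹) ∘ α`; it is here that both actions must be
  -- faithful.
  let ψ : FreeGroup (Fin n) ≃* FreeGroup (Fin n) :=
    (MonoidHom.ofInjective hα).trans <|
      (α.range.equivMapOfInjective (MulAut.conj g⁻¹).toMonoidHom (MulAut.conj g⁻¹).injective).trans <|
        (MulEquiv.subgroupCongr hg).trans (MonoidHom.ofInjective hβ).symm
  have hψ : ∀ u, β (ψ u) = g⁻¹ * α u * g := by
    intro u
    have := MonoidHom.apply_ofInjective_symm hβ (MulEquiv.subgroupCongr hg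
      (α.range.equivMapOfInjective (MulAut.conj g⁻¹).toMonoidHom (MulAut.conj g⁻¹).injective
        (MonoidHom.ofInjective hα u)))
    refine Eq.trans this ?_
    change g⁻¹ * α u * g⁻¹⁻¹ = _
    rw [inv_inv]
  refine ⟨SemidirectProduct.congr (rowAction m g⁻¹) ψ fun u => ?_⟩
  change rowAction m g⁻¹ * rowAction m (α u) = rowAction m (β (ψ u)) * rowAction m g⁻¹
  rw [← map_mul, ← map_mul, hψ, mul_inv_cancel_right]

theorem nonempty_equiv_iff_areConjugate_range {m n : ℕ} (hn : 2 ≤ n)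
    {α β : FreeGroup (Fin n) →* GL (Fin m) ℤ}
    (hα : Function.Injective α) (hβ : Function.Injective β) :
    Nonempty (FABF α ≃* FABF β) ↔ AreConjugate α.range β.range :=
  ⟨fun ⟨f⟩ => areConjugate_range_of_equiv hn f, nonempty_equiv_of_areConjugate_range hα hβ⟩

/-! ### The Hopf property -/

theorem Int.eq_of_forall_zmod {a b : ℤ} (h : ∀ N : ℕ, N ≠ 0 → (a : ZMod N) = b) : a = b := by
  -- A modulus exceeding `|b - a|` can divide `b - a` only if the difference is zero.
  have h1 := (ZMod.intCast_eq_intCast_iff_dvd_sub _ _ _).1 (h ((b - a).natAbs + 1) (by omega))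
  have h2 := Int.eq_zero_of_abs_lt_dvd h1 (by push_cast; exact lt_add_one _)
  omega

/-- The group `GL_m(ℤ)` is residually finite. -/
instance Matrix.GeneralLinearGroup.residuallyFinite_int (m : ℕ) :
    Group.ResiduallyFinite (GL (Fin m) ℤ) := by
  apply Group.residuallyFinite_of_forall_exists_finite_monoidHom
  intro g hg
  by_contra! hcon
  refine hg (Units.ext (Matrix.ext fun i j => Int.eq_of_forall_zmod fun N hN => ?_))
  have : NeZero N := ⟨hN⟩
  -- The finite quotients are the reductions modulo `N`: a matrix trivial in all of them is the
  -- identity.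
  have h1 := hcon (GL (Fin m) (ZMod N)) inferInstance inferInstance
    (Matrix.GeneralLinearGroup.map (Int.castRingHom (ZMod N)))
  have h2 := congrArg (fun A : GL (Fin m) (ZMod N) => (A : Matrix (Fin m) (Fin m) (ZMod N)) i j) h1
  simp only [Matrix.GeneralLinearGroup.map_apply] at h2
  by_cases hij : i = j <;> simpa [Matrix.one_apply, hij] using h2

theorem MonoidHom.finite_of_fg {G Q : Type*} [Group G] [Group Q] [Group.FG G] [Finite Q] :
    Finite (G →* Q) := by
  obtain ⟨S, hS⟩ := (Group.FG.out : (⊤ : Subgroup G).FG)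
  refine Finite.of_injective (fun (f : G →* Q) (s : S) => f s) fun f f' h => ?_
  exact MonoidHom.eq_of_eqOn_dense hS fun s hs => congrFun h ⟨s, hs⟩

/-- Malcev: a finitely generated residually finite group is Hopfian. -/
theorem Group.ResiduallyFinite.injective_of_surjective {G : Type*} [Group G] [Group.FG G]
    [Group.ResiduallyFinite G] (φ : G →* G) (hφ : Function.Surjective φ) :
    Function.Injective φ := by
  rw [injective_iff_map_eq_one]
  intro g hg
  by_contra hne
  obtain ⟨H, hH⟩ := Group.exists_finiteIndexNormalSubgroup_notMem g hne
  have : Finite (G →* G ⧸ H.toSubgroup) := MonoidHom.finite_of_fg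
  -- Precomposition with `φ` is injective on a finite set, hence onto. So the quotient map factors
  -- through `φ` and kills `g`, although `g ∉ H`.
  have hinj : Function.Injective fun q : G →* G ⧸ H.toSubgroup => q.comp φ :=
    fun q q' h => (MonoidHom.cancel_right hφ).1 h
  obtain ⟨q, hq⟩ := (Finite.injective_iff_surjective.1 hinj) (QuotientGroup.mk' H.toSubgroup)
  apply hH
  have h1 := DFunLike.congr_fun hq g
  simp only [MonoidHom.comp_apply, hg, map_one] at h1
  exact (QuotientGroup.eq_one_iff g).1 h1.symm

/-- If the image of a homomorphism from `F_n` to a residually finite group is free of rank `n`,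
then the homomorphism is injective. -/
theorem FreeGroup.injective_iff_nonempty_range_equiv {ι G : Type*} [Finite ι] [Group G]
    [Group.ResiduallyFinite G] (α : FreeGroup ι →* G) :
    Function.Injective α ↔ Nonempty (α.range ≃* FreeGroup ι) := by
  refine ⟨fun h => ⟨(MonoidHom.ofInjective h).symm⟩, fun ⟨e⟩ => ?_⟩
  have hfg : Group.FG α.range := Group.fg_of_surjective (f := e.symm.toMonoidHom) e.symm.surjective
  -- Composing with `e` turns `α` into a surjective endomorphism of its range, to which the Hopf
  -- property applies.
  have h1 : Function.Injective (α.rangeRestrict.comp e.toMonoidHom) :=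
    Group.ResiduallyFinite.injective_of_surjective _
      (α.rangeRestrict_surjective.comp e.surjective)
  intro x y hxy
  obtain ⟨x, rfl⟩ := e.surjective x
  obtain ⟨y, rfl⟩ := e.surjective y
  exact congrArg e (h1 (Subtype.ext hxy))

/-! ### Reductions between decision problems -/

namespace DecisionProblem

/-- `P` reduces to `Q`: there is a partial recursive function, defined on all legitimate inputs of
`P`, that turns exactly the legitimate inputs of `P` into legitimate inputs of `Q`, and preserves
the answers. -/
def Reduces {α β : Type} [Primcodable α] [Primcodable β] (P : DecisionProblem α)
    (Q : DecisionProblem β) : Prop :=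
  ∃ r : α →. β, Partrec r ∧ (∀ x, P.input x → (r x).Dom) ∧
    ∀ x, ∀ y ∈ r x, (P.input x ↔ Q.input y) ∧ (P.input x → (P.cond x ↔ Q.cond y))

theorem mem_answer {α : Type} {P : DecisionProblem α} {x : α} {b : Bool} :
    b ∈ P.answer x ↔ P.input x ∧ (b = true ↔ P.cond x) := by
  classical
  constructor
  · rintro ⟨h, rfl⟩
    exact ⟨h, by simp [answer]⟩
  · rintro ⟨h, hb⟩
    refine ⟨h, ?_⟩
    rw [Bool.eq_iff_iff, hb]
    simp [answer]

variable {α β γ : Type} [Primcodable α] [Primcodable β] [Primcodable γ]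
  {P : DecisionProblem α} {Q : DecisionProblem β}

theorem Reduces.isDecidable (h : P.Reduces Q) (hQ : Q.IsDecidable) : P.IsDecidable := by
  obtain ⟨r, hr, hdom, hy⟩ := h
  obtain ⟨f, hf, hcorrect⟩ := hQ
  refine ⟨fun x => (r x).bind f, hr.bind (hf.comp Computable.snd).to₂, fun x hx => ?_⟩
  obtain ⟨y, hyr⟩ := Part.dom_iff_mem.1 (hdom x hx)
  obtain ⟨h1, h2⟩ := hy x y hyr
  obtain ⟨b, hb, hb'⟩ := hcorrect y (h1.1 hx)
  refine ⟨b, ?_, hb'.trans (h2 hx).symm⟩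
  change (r x).bind (fun y => f y) = _
  rw [Part.eq_some_iff.2 hyr, Part.bind_some, hb]

/-- One oracle call after `r`. The equivalence of legitimacy in `Reduces` makes the domains agree:
on an illegitimate input either `r` or the oracle diverges. -/
theorem Reduces.turingReducible (h : P.Reduces Q) : P.coded ≤ᵀ Q.coded := by
  obtain ⟨r, hr, hdom, hy⟩ := h
  have hc := Nat.RecursiveIn.comp (O := {Q.coded}) (.oracle _ rfl) (Nat.Partrec.recursiveIn hr)
  rw [TuringReducible, RecursiveIn.iff_nat]
  refine hc.of_eq fun k => ?_
  refine (Part.bind_assoc _ _ _).trans ?_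
  change _ = Part.bind _ _
  congr 1
  funext x
  have hmap : (Part.map Encodable.encode (r x)).bind Q.coded =
      (r x).bind fun y => Q.coded (Encodable.encode y) := Part.bind_map _ _ _
  rw [hmap]
  simp only [coded, Encodable.encodek, Part.coe_some, Part.bind_some]
  ext c
  simp only [Part.mem_bind_iff, Part.mem_map_iff, mem_answer]
  constructor
  · rintro ⟨y, hyr, b, ⟨hi, hb⟩, rfl⟩
    obtain ⟨h1, h2⟩ := hy x y hyr
    exact ⟨b, ⟨h1.2 hi, hb.trans (h2 (h1.2 hi)).symm⟩, rfl⟩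
  · rintro ⟨b, ⟨hi, hb⟩, rfl⟩
    obtain ⟨y, hyr⟩ := Part.dom_iff_mem.1 (hdom x hi)
    obtain ⟨h1, h2⟩ := hy x y hyr
    exact ⟨y, hyr, b, ⟨h1.1 hi, hb.trans (h2 hi)⟩, rfl⟩

/-- A reduction that searches for a certificate `c` with `R x c` and returns `g x c`. -/
theorem Reduces.of_certificate {R : α → γ → Prop} [∀ x c, Decidable (R x c)]
    (hR : PrimrecRel R) {g : α → γ → β} (hg : Primrec₂ g) (hex : ∀ x, P.input x → ∃ c, R x c)
    (h : ∀ x c, R x c → (P.input x ↔ Q.input (g x c)) ∧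
      (P.input x → (P.cond x ↔ Q.cond (g x c)))) : P.Reduces Q := by
  -- Stage `k` of the search tests the certificate with code `k`.
  let s : α → ℕ → Option β := fun x k =>
    (Encodable.decode (α := γ) k).bind fun c => if R x c then some (g x c) else none
  have hs : Primrec₂ s := by
    refine Primrec.option_bind (Primrec.decode.comp Primrec.snd) ?_
    exact Primrec.ite (hR.comp (Primrec.fst.comp Primrec.fst) Primrec.snd)
      (Primrec.option_some.comp (hg.comp (Primrec.fst.comp Primrec.fst) Primrec.snd))
      (Primrec.const none)
  have hmem : ∀ x k y, y ∈ s x k → ∃ c, R x c ∧ g x c = y := by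
    intro x k y hy
    obtain ⟨c, -, hc⟩ := Option.bind_eq_some_iff.1 hy
    by_cases hRc : R x c
    · exact ⟨c, hRc, by simpa [hRc] using hc⟩
    · simp [hRc] at hc
  refine ⟨fun x => Nat.rfindOpt (s x), Partrec.rfindOpt hs.to_comp, fun x hx => ?_,
    fun x y hy => ?_⟩
  · obtain ⟨c, hc⟩ := hex x hx
    exact Nat.rfindOpt_dom.2 ⟨Encodable.encode c, g x c, by simp [s, hc]⟩
  · obtain ⟨k, hk⟩ := Nat.rfindOpt_spec hy
    obtain ⟨c, hc, rfl⟩ := hmem x k y hk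
    exact h x c hc

end DecisionProblem

/-! ### Primitive recursive integer and matrix arithmetic -/

namespace Primrec

theorem int_toNat : Primrec Int.toNat := by
  have h : Primrec (Equiv.intEquivNat : ℤ → ℕ) := Primrec.of_equiv
  -- Even codes `2 * k` stand for `k`, odd codes `2 * k + 1` for `-(k + 1)`.
  refine (Primrec.ite (Primrec.eq.comp (Primrec.nat_mod.comp h (Primrec.const 2))
    (Primrec.const 0)) (Primrec.nat_div.comp h (Primrec.const 2)) (Primrec.const 0)).of_eq
    fun z => ?_
  rcases z with k | k
  · change (if (2 * k) % 2 = 0 then (2 * k) / 2 else 0) = k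
    rw [if_pos (by omega)]; omega
  · change (if (2 * k + 1) % 2 = 0 then (2 * k + 1) / 2 else 0) = 0
    rw [if_neg (by omega)]

theorem int_neg : Primrec (Neg.neg : ℤ → ℤ) := by
  have h : Primrec (Equiv.intEquivNat : ℤ → ℕ) := Primrec.of_equiv
  refine (Primrec.of_equiv_iff Equiv.intEquivNat).1 ?_
  -- Negation swaps the codes `2 * k` and `2 * k - 1` for `k > 0`; truncated subtraction fixes the
  -- code `0`.
  refine (Primrec.ite (Primrec.eq.comp (Primrec.nat_mod.comp h (Primrec.const 2))
    (Primrec.const 0)) (Primrec.nat_sub.comp h (Primrec.const 1)) (Primrec.succ.comp h)).of_eq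
    fun z => ?_
  rcases z with (_ | k) | k
  · rfl
  · change (if (2 * (k + 1)) % 2 = 0 then 2 * (k + 1) - 1 else 2 * (k + 1) + 1) = 2 * k + 1
    rw [if_pos (by omega)]; omega
  · change (if (2 * k + 1) % 2 = 0 then 2 * k + 1 - 1 else (2 * k + 1) + 1) = 2 * (k + 1)
    rw [if_neg (by omega)]; omega

theorem int_natCast : Primrec (Nat.cast : ℕ → ℤ) :=
  (Primrec.of_equiv_iff Equiv.intEquivNat).1
    ((Primrec.nat_mul.comp (Primrec.const 2) Primrec.id).of_eq fun _ => rfl)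

theorem int_subNat : Primrec₂ fun p q : ℕ => (p : ℤ) - q := by
  refine (Primrec.ite (Primrec.nat_le.comp Primrec.snd Primrec.fst)
    (int_natCast.comp (Primrec.nat_sub.comp Primrec.fst Primrec.snd))
    (int_neg.comp (int_natCast.comp (Primrec.nat_sub.comp Primrec.snd Primrec.fst)))).of_eq
    fun p => ?_
  dsimp only
  split_ifs <;> omega

theorem int_add : Primrec₂ ((· + ·) : ℤ → ℤ → ℤ) := by
  refine (int_subNat.comp
    (Primrec.nat_add.comp (int_toNat.comp Primrec.fst) (int_toNat.comp Primrec.snd))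
    (Primrec.nat_add.comp (int_toNat.comp (int_neg.comp Primrec.fst))
      (int_toNat.comp (int_neg.comp Primrec.snd)))).of_eq fun p => ?_
  dsimp only
  omega

theorem int_mul : Primrec₂ ((· * ·) : ℤ → ℤ → ℤ) := by
  have hp := int_toNat.comp (Primrec.fst (α := ℤ) (β := ℤ))
  have hp' := int_toNat.comp (int_neg.comp (Primrec.fst (α := ℤ) (β := ℤ)))
  have hq := int_toNat.comp (Primrec.snd (α := ℤ) (β := ℤ))
  have hq' := int_toNat.comp (int_neg.comp (Primrec.snd (α := ℤ) (β := ℤ)))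
  -- Expand the product of two differences `z⁺ - z⁻` of natural numbers.
  refine (int_subNat.comp
    (Primrec.nat_add.comp (Primrec.nat_mul.comp hp hq) (Primrec.nat_mul.comp hp' hq'))
    (Primrec.nat_add.comp (Primrec.nat_mul.comp hp hq') (Primrec.nat_mul.comp hp' hq))).of_eq
    fun p => ?_
  have h1 : p.1 = (p.1.toNat : ℤ) - (-p.1).toNat := by omega
  have h2 : p.2 = (p.2.toNat : ℤ) - (-p.2).toNat := by omega
  conv_rhs => rw [h1, h2]
  push_cast
  ring

theorem int_sum {α ι : Type*} [Primcodable α] (s : Finset ι) {f : α → ι → ℤ}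
    (hf : ∀ i, Primrec fun a => f a i) : Primrec fun a => ∑ i ∈ s, f a i := by
  classical
  induction s using Finset.induction_on with
  | empty => simpa using Primrec.const (0 : ℤ)
  | insert i s hi ih => simpa only [Finset.sum_insert hi] using int_add.comp (hf i) ih

theorem finArrow_mk {α σ : Type*} [Primcodable α] [Primcodable σ] {n : ℕ} {f : α → Fin n → σ}
    (hf : ∀ i, Primrec fun a => f a i) : Primrec f :=
  Primrec.fin_curry.2 (Primrec.fin_curry₁ (f := fun i a => f a i) |>.2 hf).swap

theorem finArrow_apply {α σ : Type*} [Primcodable α] [Primcodable σ] {n : ℕ} {f : α → Fin n → σ}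
    (hf : Primrec f) (i : Fin n) : Primrec fun a => f a i :=
  Primrec.fin_app.comp hf (Primrec.const i)

theorem matrix_mul {m : ℕ} :
    Primrec₂ ((· * ·) : Matrix (Fin m) (Fin m) ℤ → Matrix (Fin m) (Fin m) ℤ → _) := by
  have entry : ∀ i j, Primrec fun A : Matrix (Fin m) (Fin m) ℤ => A i j := fun i j =>
    finArrow_apply (finArrow_apply (α := Fin m → Fin m → ℤ) Primrec.id i) j
  refine finArrow_mk (σ := Fin m → ℤ) fun i => finArrow_mk fun j => ?_
  refine (int_sum Finset.univ (fun k => int_mul.comp ((entry i k).comp Primrec.fst)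
    ((entry k j).comp Primrec.snd))).of_eq fun p => ?_
  simp [Matrix.mul_apply]

theorem list_ofFn_self {σ : Type*} [Primcodable σ] {n : ℕ} :
    Primrec (List.ofFn : (Fin n → σ) → List σ) :=
  Primrec.list_ofFn (f := fun i (a : Fin n → σ) => a i) fun i => finArrow_apply Primrec.id i

end Primrec

/-! ### Words -/

theorem evalWord_eq_lift_mk {G ι : Type*} [Group G] (X : ι → G) (w : List (ι × Bool)) :
    evalWord X w = FreeGroup.lift X (FreeGroup.mk w) := by
  rw [FreeGroup.lift_mk, evalWord]
  congr 2
  funext l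
  cases l.2 <;> rfl

theorem mem_closure_range_iff_exists_evalWord {G ι : Type*} [Group G] {X : ι → G} {g : G} :
    g ∈ Subgroup.closure (Set.range X) ↔ ∃ w, evalWord X w = g := by
  rw [← FreeGroup.range_lift_eq_closure]
  constructor
  · rintro ⟨u, rfl⟩
    classical exact ⟨u.toWord, by rw [evalWord_eq_lift_mk, FreeGroup.mk_toWord]⟩
  · rintro ⟨w, rfl⟩
    exact ⟨_, (evalWord_eq_lift_mk X w).symm⟩

/-- Substitution of words for the letters of a word. -/
def substWord {ι κ : Type*} (f : ι → List (κ × Bool)) (w : List (ι × Bool)) : List (κ × Bool) :=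
  w.flatMap fun l => if l.2 then f l.1 else FreeGroup.invRev (f l.1)

theorem evalWord_substWord {G ι κ : Type*} [Group G] (X : κ → G) (f : ι → List (κ × Bool))
    (w : List (ι × Bool)) :
    evalWord X (substWord f w) = evalWord (fun i => evalWord X (f i)) w := by
  have hinv : ∀ v : List (κ × Bool), evalWord X (FreeGroup.invRev v) = (evalWord X v)⁻¹ := by
    intro v
    rw [evalWord_eq_lift_mk, evalWord_eq_lift_mk, ← FreeGroup.inv_mk, map_inv]
  induction w with
  | nil => rfl
  | cons l w ih =>
    have happ : ∀ v v' : List (κ × Bool), evalWord X (v ++ v') = evalWord X v * evalWord X v' := by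
      intro v v'
      simp [evalWord]
    rw [substWord, List.flatMap_cons, happ, ← substWord, ih]
    change _ = (if l.2 then evalWord X (f l.1) else (evalWord X (f l.1))⁻¹) * _
    split_ifs
    · rfl
    · rw [hinv]; rfl

theorem wordSubgroup_ofFn {G ι : Type*} [Group G] (X : ι → G) {n : ℕ}
    (w : Fin n → List (ι × Bool)) :
    wordSubgroup X (List.ofFn w) = (FreeGroup.lift fun i => evalWord X (w i)).range := by
  rw [FreeGroup.range_lift_eq_closure, wordSubgroup]
  congr 1
  ext g
  simp [List.mem_ofFn]

/-- Padding `S` with empty words, whose value is `1`, gives one alphabet `ℕ` for words in the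
members of `S`, independent of its length. -/
theorem wordSubgroup_eq_closure_range_getD {G ι : Type*} [Group G] (X : ι → G)
    (S : List (List (ι × Bool))) :
    wordSubgroup X S = Subgroup.closure (Set.range fun j => evalWord X (S.getD j [])) := by
  apply le_antisymm <;> rw [wordSubgroup, Subgroup.closure_le]
  · rintro _ ⟨w, hw, rfl⟩
    obtain ⟨j, hj, rfl⟩ := List.getElem_of_mem hw
    exact Subgroup.subset_closure ⟨j, by simp [hj]⟩
  · rintro _ ⟨j, rfl⟩
    by_cases hj : j < S.length
    · exact Subgroup.subset_closure ⟨S[j], List.getElem_mem hj, by simp [hj]⟩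
    · beta_reduce
      rw [List.getD_eq_default _ _ (not_lt.1 hj)]
      exact one_mem _

namespace Primrec

/-- The values of the finitely many letters form a fixed table, so no matrix inverse has to be
computed. -/
theorem evalWord_val {m k : ℕ} (X : Fin k → GL (Fin m) ℤ) :
    Primrec fun w => ((evalWord X w : GL (Fin m) ℤ) : Matrix (Fin m) (Fin m) ℤ) := by
  let L : Fin k × Bool → Matrix (Fin m) (Fin m) ℤ := fun l =>
    ((if l.2 then X l.1 else (X l.1)⁻¹ : GL (Fin m) ℤ) : Matrix (Fin m) (Fin m) ℤ)
  refine (Primrec.list_foldr (h := fun _ p => L p.1 * p.2) Primrec.id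
    (Primrec.const (1 : Matrix (Fin m) (Fin m) ℤ))
    (matrix_mul.comp ((Primrec.dom_finite L).comp (Primrec.fst.comp Primrec.snd))
      (Primrec.snd.comp Primrec.snd)).to₂).of_eq fun w => ?_
  induction w with
  | nil => rfl
  | cons l w ih =>
    simp only [id] at ih ⊢
    rw [List.foldr_cons, ih, ← Units.val_mul]
    rfl

theorem substWord {α ι κ : Type*} [Primcodable α] [Primcodable ι] [Primcodable κ]
    {f : α → ι → List (κ × Bool)} (hf : Primrec₂ f) {w : α → List (ι × Bool)} (hw : Primrec w) :
    Primrec fun a => _root_.substWord (f a) (w a) := by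
  have hinv : Primrec (FreeGroup.invRev : List (κ × Bool) → List (κ × Bool)) :=
    Primrec.list_reverse.comp (Primrec.list_map Primrec.id
      (Primrec.pair (Primrec.fst.comp Primrec.snd)
        (Primrec.not.comp (Primrec.snd.comp Primrec.snd))).to₂)
  have hfl : Primrec fun p : α × ι × Bool => f p.1 p.2.1 :=
    hf.comp Primrec.fst (Primrec.fst.comp Primrec.snd)
  exact Primrec.list_flatMap hw (Primrec.ite
    (Primrec.eq.comp (Primrec.snd.comp Primrec.snd) (Primrec.const true)) hfl
    (hinv.comp hfl)).to₂

end Primrec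

/-! ### The isomorphism problem and the free subgroup conjugacy problem -/

theorem Represents.eq {m n : ℕ} {A : Fin n → Matrix (Fin m) (Fin m) ℤ}
    {α α' : FreeGroup (Fin n) →* GL (Fin m) ℤ} (h : Represents A α) (h' : Represents A α') :
    α' = α :=
  FreeGroup.ext_hom _ _ fun i => Units.ext ((h' i).trans (h i).symm)

theorem represents_lift {m n : ℕ} (a : Fin n → GL (Fin m) ℤ) :
    Represents (fun i => (a i : Matrix (Fin m) (Fin m) ℤ)) (FreeGroup.lift a) := fun i => by
  rw [FreeGroup.lift_apply_of]

/-- If the tuples of matrices and the lists of words describe the same pair of subgroups, then the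
two problems agree on them. -/
theorem faithfulIP_iff_CFSCP {m n : ℕ} (hn : 2 ≤ n) {ι : Type} {X : ι → GL (Fin m) ℤ}
    {p : (Fin n → Matrix (Fin m) (Fin m) ℤ) × (Fin n → Matrix (Fin m) (Fin m) ℤ)}
    {q : List (List (ι × Bool)) × List (List (ι × Bool))}
    {α β : FreeGroup (Fin n) →* GL (Fin m) ℤ} (hα : Represents p.1 α) (hβ : Represents p.2 β)
    (h1 : α.range = wordSubgroup X q.1) (h2 : β.range = wordSubgroup X q.2) :
    ((faithfulIP m n).input p ↔ (CFSCP X n).input q) ∧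
      ((faithfulIP m n).input p → ((faithfulIP m n).cond p ↔ (CFSCP X n).cond q)) := by
  have hin : (faithfulIP m n).input p ↔ Function.Injective α ∧ Function.Injective β := by
    constructor
    · rintro ⟨α', β', hα', hβ', h⟩
      rwa [hα.eq hα', hβ.eq hβ'] at h
    · exact fun h => ⟨α, β, hα, hβ, h⟩
  have hcond : (faithfulIP m n).cond p ↔ Nonempty (FABF α ≃* FABF β) := by
    constructor
    · rintro ⟨α', β', hα', hβ', h⟩
      obtain rfl := hα.eq hα'
      obtain rfl := hβ.eq hβ'
      exact h
    · exact fun h => ⟨α, β, hα, hβ, h⟩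
  refine ⟨?_, fun h => ?_⟩
  · rw [hin, FreeGroup.injective_iff_nonempty_range_equiv,
      FreeGroup.injective_iff_nonempty_range_equiv, h1, h2]
    rfl
  · obtain ⟨hiα, hiβ⟩ := hin.1 h
    rw [hcond, nonempty_equiv_iff_areConjugate_range hn hiα hiβ, h1, h2]
    rfl

/-- The certificate consists of words spelling the given matrices; these exist because `X`
generates. -/
theorem faithfulIP_reduces_CFSCP {m n : ℕ} (hn : 2 ≤ n) {k : ℕ} {X : Fin k → GL (Fin m) ℤ}
    (hX : Subgroup.closure (Set.range X) = ⊤) : (faithfulIP m n).Reduces (CFSCP X n) := by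
  let M : List (Fin k × Bool) → Matrix (Fin m) (Fin m) ℤ := fun w => (evalWord X w : GL (Fin m) ℤ)
  have hM : Primrec M := Primrec.evalWord_val X
  have hMf : Primrec fun (w : Fin n → List (Fin k × Bool)) i => M (w i) :=
    Primrec.finArrow_mk fun i => hM.comp (Primrec.finArrow_apply Primrec.id i)
  have hword : ∀ α : FreeGroup (Fin n) →* GL (Fin m) ℤ,
      ∃ w : Fin n → List (Fin k × Bool), ∀ i, evalWord X (w i) = α (FreeGroup.of i) := by
    intro α
    choose w hw using fun i => mem_closure_range_iff_exists_evalWord.1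
      (hX ▸ Subgroup.mem_top (α (FreeGroup.of i)))
    exact ⟨w, hw⟩
  refine DecisionProblem.Reduces.of_certificate
    (γ := (Fin n → List (Fin k × Bool)) × (Fin n → List (Fin k × Bool)))
    (R := fun p c => (fun i => M (c.1 i)) = p.1 ∧ (fun i => M (c.2 i)) = p.2)
    (g := fun _ c => (List.ofFn c.1, List.ofFn c.2)) ?_ ?_ ?_ ?_
  · exact PrimrecPred.and
      (Primrec.eq.comp (hMf.comp (Primrec.fst.comp Primrec.snd)) (Primrec.fst.comp Primrec.fst))
      (Primrec.eq.comp (hMf.comp (Primrec.snd.comp Primrec.snd)) (Primrec.snd.comp Primrec.fst))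
  · exact Primrec.pair (Primrec.list_ofFn_self.comp (Primrec.fst.comp Primrec.snd))
      (Primrec.list_ofFn_self.comp (Primrec.snd.comp Primrec.snd))
  · rintro p ⟨α, β, hα, hβ, -⟩
    obtain ⟨v, hv⟩ := hword α
    obtain ⟨w, hw⟩ := hword β
    exact ⟨(v, w), funext fun i => by simp only [M, hv]; exact hα i,
      funext fun i => by simp only [M, hw]; exact hβ i⟩
  · rintro ⟨_, _⟩ ⟨v, w⟩ ⟨rfl, rfl⟩
    exact faithfulIP_iff_CFSCP hn (represents_lift _) (represents_lift _)
      (wordSubgroup_ofFn X v).symm (wordSubgroup_ofFn X w).symm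

/-- The words obtained from those of `S` by substitution into the words `v i`. -/
def wordTuple {ι : Type*} {n : ℕ} (S : List (List (ι × Bool)))
    (v : Fin n → List (ℕ × Bool)) (i : Fin n) : List (ι × Bool) :=
  substWord (fun j => S.getD j []) (v i)

/-- The words `u` show that the words of `S` spell elements of the subgroup generated by the tuple
given by `v`. -/
def IsGeneratingCertificate {G ι : Type*} [Group G] (X : ι → G) {n : ℕ}
    (S : List (List (ι × Bool))) (c : (Fin n → List (ℕ × Bool)) × List (List (Fin n × Bool))) :
    Prop :=
  c.2.map (fun t => evalWord X (substWord (wordTuple S c.1) t)) = S.map (evalWord X)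

theorem IsGeneratingCertificate.range_eq {G ι : Type*} [Group G] {X : ι → G} {n : ℕ}
    {S : List (List (ι × Bool))} {c : (Fin n → List (ℕ × Bool)) × List (List (Fin n × Bool))}
    (h : IsGeneratingCertificate X S c) :
    (FreeGroup.lift fun i => evalWord X (wordTuple S c.1 i)).range = wordSubgroup X S := by
  apply le_antisymm
  · rw [FreeGroup.range_lift_eq_closure, Subgroup.closure_le, wordSubgroup_eq_closure_range_getD]
    rintro _ ⟨i, rfl⟩
    exact mem_closure_range_iff_exists_evalWord.2 ⟨c.1 i, (evalWord_substWord X _ _).symm⟩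
  · rw [wordSubgroup, Subgroup.closure_le]
    rintro _ ⟨w, hw, rfl⟩
    have hmem : evalWord X w ∈ S.map (evalWord X) := List.mem_map_of_mem hw
    rw [← h] at hmem
    obtain ⟨t, -, ht⟩ := List.mem_map.1 hmem
    rw [SetLike.mem_coe, FreeGroup.range_lift_eq_closure, mem_closure_range_iff_exists_evalWord]
    exact ⟨t, by rw [← ht, evalWord_substWord]⟩

/-- Transport the standard basis through `e.symm`: the words `v` spell this basis in terms of `S`,
and the words `u` spell `S` in terms of the basis. -/
theorem exists_isGeneratingCertificate {G ι : Type*} [Group G] (X : ι → G) {n : ℕ}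
    (S : List (List (ι × Bool))) (e : wordSubgroup X S ≃* FreeGroup (Fin n)) :
    ∃ c : (Fin n → List (ℕ × Bool)) × List (List (Fin n × Bool)),
      IsGeneratingCertificate X S c := by
  let b : Fin n → G := fun i => (e.symm (FreeGroup.of i) : G)
  have hb : ∀ i, b i ∈ Subgroup.closure (Set.range fun j => evalWord X (S.getD j [])) := fun i =>
    wordSubgroup_eq_closure_range_getD X S ▸ (e.symm (FreeGroup.of i)).2
  choose v hv using fun i => mem_closure_range_iff_exists_evalWord.1 (hb i)
  have hv' : (fun i => evalWord X (wordTuple S v i)) = b := funext fun i => by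
    rw [wordTuple, evalWord_substWord, hv]
  have hlift : FreeGroup.lift b = (wordSubgroup X S).subtype.comp e.symm.toMonoidHom :=
    FreeGroup.ext_hom _ _ fun i => by simp [b]
  have hS : ∀ w : {w // w ∈ S}, ∃ t, evalWord b t = evalWord X w.1 := by
    rintro ⟨w, hw⟩
    rw [← mem_closure_range_iff_exists_evalWord, ← FreeGroup.range_lift_eq_closure, hlift]
    exact ⟨e ⟨evalWord X w, Subgroup.subset_closure ⟨w, hw, rfl⟩⟩, by simp⟩
  choose u hu using hS
  refine ⟨(v, S.attach.map u), ?_⟩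
  rw [IsGeneratingCertificate, List.map_map, ← List.attach_map_val (l := S) (f := evalWord X)]
  refine List.map_congr_left fun w _ => ?_
  simp only [Function.comp_apply, evalWord_substWord, hv', hu]

/-- A certificate picks `n` elements generating the same subgroup, and their matrices form the
output. Checking it compares integer matrices only; freeness is never tested. -/
theorem CFSCP_reduces_faithfulIP {m n : ℕ} (hn : 2 ≤ n) {k : ℕ} (X : Fin k → GL (Fin m) ℤ) :
    (CFSCP X n).Reduces (faithfulIP m n) := by
  let M : List (Fin k × Bool) → Matrix (Fin m) (Fin m) ℤ := fun w => (evalWord X w : GL (Fin m) ℤ)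
  have hM : Primrec M := Primrec.evalWord_val X
  have hinj : Function.Injective (Units.val : GL (Fin m) ℤ → _) := Units.val_injective
  let T : (List (List (Fin k × Bool)) ×
      (Fin n → List (ℕ × Bool)) × List (List (Fin n × Bool))) → Fin n → List (Fin k × Bool) :=
    fun a => wordTuple a.1 a.2.1
  have hT : Primrec T := Primrec.finArrow_mk fun i =>
    Primrec.substWord ((Primrec.list_getD []).comp (Primrec.fst.comp Primrec.fst) Primrec.snd).to₂
      (Primrec.finArrow_apply (Primrec.fst.comp Primrec.snd) i)
  have hcert : PrimrecRel fun (S : List (List (Fin k × Bool)))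
      (c : (Fin n → List (ℕ × Bool)) × List (List (Fin n × Bool))) =>
      c.2.map (fun t => M (substWord (wordTuple S c.1) t)) = S.map M :=
    Primrec.eq.comp
      (Primrec.list_map (Primrec.snd.comp Primrec.snd) (hM.comp (Primrec.substWord
        (f := fun (p : _ × _) => T p.1)
        (Primrec.fin_app.comp (hT.comp (Primrec.fst.comp Primrec.fst)) Primrec.snd).to₂
        Primrec.snd)).to₂)
      (Primrec.list_map Primrec.fst (hM.comp Primrec.snd).to₂)
  have hiff : ∀ (S : List (List (Fin k × Bool)))
      (c : (Fin n → List (ℕ × Bool)) × List (List (Fin n × Bool))),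
      c.2.map (fun t => M (substWord (wordTuple S c.1) t)) = S.map M ↔
        IsGeneratingCertificate X S c := by
    intro S c
    rw [IsGeneratingCertificate, ← (List.map_injective_iff.2 hinj).eq_iff, List.map_map,
      List.map_map]
    rfl
  have hMT : Primrec fun a i => M (T a i) :=
    Primrec.finArrow_mk fun i => hM.comp (Primrec.finArrow_apply hT i)
  refine DecisionProblem.Reduces.of_certificate
    (γ := ((Fin n → List (ℕ × Bool)) × List (List (Fin n × Bool))) ×
      ((Fin n → List (ℕ × Bool)) × List (List (Fin n × Bool))))
    (R := fun q c =>
      c.1.2.map (fun t => M (substWord (wordTuple q.1 c.1.1) t)) = q.1.map M ∧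
      c.2.2.map (fun t => M (substWord (wordTuple q.2 c.2.1) t)) = q.2.map M)
    (g := fun q c => (fun i => M (T (q.1, c.1) i), fun i => M (T (q.2, c.2) i))) ?_ ?_ ?_ ?_
  · exact PrimrecPred.and
      (hcert.comp (Primrec.fst.comp Primrec.fst) (Primrec.fst.comp Primrec.snd))
      (hcert.comp (Primrec.snd.comp Primrec.fst) (Primrec.snd.comp Primrec.snd))
  · exact Primrec.pair
      (hMT.comp (Primrec.pair (Primrec.fst.comp Primrec.fst) (Primrec.fst.comp Primrec.snd)))
      (hMT.comp (Primrec.pair (Primrec.snd.comp Primrec.fst) (Primrec.snd.comp Primrec.snd)))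
  · rintro q ⟨⟨e⟩, ⟨e'⟩⟩
    obtain ⟨c, hc⟩ := exists_isGeneratingCertificate X q.1 e
    obtain ⟨c', hc'⟩ := exists_isGeneratingCertificate X q.2 e'
    exact ⟨(c, c'), (hiff _ _).2 hc, (hiff _ _).2 hc'⟩
  · rintro q c ⟨hc, hc'⟩
    obtain ⟨h1, h2⟩ := faithfulIP_iff_CFSCP hn
      (p := (fun i => M (T (q.1, c.1) i), fun i => M (T (q.2, c.2) i)))
      (represents_lift _) (represents_lift _)
      ((hiff _ _).1 hc).range_eq ((hiff _ _).1 hc').range_eq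
    exact ⟨h1.symm, fun h => (h2 (h1.2 h)).symm⟩

theorem mainTheorem8 (m n : ℕ) (hm : 1 ≤ m) (hn : 2 ≤ n) :
    (∀ α β : FreeGroup (Fin n) →* GL (Fin m) ℤ, Function.Injective α → Function.Injective β →
      (Nonempty (FABF α ≃* FABF β) ↔ AreConjugate α.range β.range)) ∧
    ∀ (k : ℕ) (X : Fin k → GL (Fin m) ℤ), Subgroup.closure (Set.range X) = ⊤ →
      ((faithfulIP m n).TuringEquiv (CFSCP X n) ∧
        ((faithfulIP m n).IsDecidable ↔ (CFSCP X n).IsDecidable)) := by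
  refine ⟨fun α β hα hβ => nonempty_equiv_iff_areConjugate_range hn hα hβ, fun k X hX => ?_⟩
  have h1 := faithfulIP_reduces_CFSCP hn hX
  have h2 := CFSCP_reduces_faithfulIP hn X
  exact ⟨⟨h1.turingReducible, h2.turingReducible⟩, h2.isDecidable, h1.isDecidable⟩
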